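/- **Theorem (oracle inequality for the penalized MLE).** Let $1 \le k \le n/4$ and let $G$ be a bipartite simple graph with left nodes $\{1,\dots,n\}$, right nodes $\{1,\dots,m\}$ and regular left degree $d$, which is a $(2k,1/16)$-expander: every nonempty set $S$ of at most $2k$ left nodes has more than $(1-\tfrac1{16})\,d\,|S|$ neighbors. Let $F \in \{0,1\}^{m\times n}$ be the adjacency matrix of $G$ and $\Phi = F/d$. For $g \in \mathbb{R}_+^m$ let $\mathbb{P}_g$ be the law on $\mathbb{Z}_+^m$ of a vector with independent coordinates $y_j \sim \mathrm{Poisson}(g_j)$, where $\mathrm{Poisson}(0)$ is the point mass at $0$. Let $\theta^* \in \mathbb{R}_+^n$ with $\|\theta^*\|_1 = L$, and let $y \sim \mathbb{P}_{\Phi\theta^*}$. Let $\Theta_L$ be a finite or countable set of vectors $\theta \in \mathbb{R}_+^n$ with $\|\theta\|_1 \le L$, and let $\mathrm{pen} : \Theta_L \to \mathbb{R}_+$ satisfy the Kraft inequality $\sum_{\theta\in\Theta_L} e^{-\mathrm{pen}(\theta)} \le 1$. Let $\hat\theta = \hat\theta(y) \in \Theta_L$ be a penalized maximum likelihood estimator,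 i.e. for every $y \in \mathbb{Z}_+^m$, $$\hat\theta(y) \in \operatorname*{arg\,min}_{\theta\in\Theta_L}\bigl[-\log \mathbb{P}_{\Phi\theta}(y) + 2\,\mathrm{pen}(\theta)\bigr] \qquad (-\log 0 = +\infty).$$ Let $\theta^{*(k)}$ be a best $k$-term approximation of $\theta^*$, obtained by setting to zero all coordinates of $\theta^*$ except $k$ coordinates that are largest in magnitude (ties broken arbitrarily). Then the minimum below is attained and $$\mathbb{E}_{\Phi\theta^*}\|\hat\theta - \theta^*\|_1 \;\le\; 4\,\|\theta^* - \theta^{*(k)}\|_1 + 8\sqrt{L\,\min_{\theta\in\Theta_L}\bigl[\mathrm{KL}(\mathbb{P}_{\Phi\theta^*}\,\|\,\mathbb{P}_{\Phi\theta}) + 2\,\mathrm{pen}(\theta)\bigr]},$$ where $\mathrm{KL}(\mathbb{P}_g\|\mathbb{P}_h) = \sum_{y\in\mathbb{Z}_+^m} \mathbb{P}_g(y)\log\frac{\mathbb{P}_g(y)}{\mathbb{P}_h(y)} \in [0,+\infty]$ is the Kullback-Leibler divergence, equal to $+\infty$ if $\mathbb{P}_h(y)=0<\mathbb{P}_g(y)$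 for some $y$ (and $0\cdot\infty = 0$; the right-hand side is $+\infty$ when $L>0$ and the minimum is $+\infty$). -/

import Mathlib

open MeasureTheory ProbabilityTheory
open scoped NNReal ENNReal Matrix

noncomputable section

namespace PoissonExpander

/-- The `ℓ₁` norm of a real vector. -/
def l1Norm {n : ℕ} (u : Fin n → ℝ) : ℝ := ∑ i, |u i|

/-- The vector `u^S` obtained from `u` by setting to zero all coordinates outside `S`. -/
def restrictTo {n : ℕ} (S : Finset (Fin n)) (u : Fin n → ℝ) : Fin n → ℝ :=
  fun i => if i ∈ S then u i else 0

/-- `v` is a best `k`-term approximation of `u`: `v = u^S`, where `S` is a set of positions of `k`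
coordinates of `u` that are largest in magnitude (ties may be broken in any way). -/
def IsBestKTermApprox {n : ℕ} (k : ℕ) (u v : Fin n → ℝ) : Prop :=
  ∃ S : Finset (Fin n), S.card = k ∧ (∀ i ∈ S, ∀ j ∉ S, |u j| ≤ |u i|) ∧ v = restrictTo S u

open Classical in
/-- The set of neighbours of a set `S` of left nodes, in the bipartite simple graph with left
nodes `Fin n`, right nodes `Fin m`, and an edge between `a` and `b` exactly when `E a b`. -/
def neighbors {n m : ℕ} (E : Fin n → Fin m → Prop) (S : Finset (Fin n)) : Finset (Fin m) :=
  Finset.univ.filter fun b => ∃ a ∈ S, E a b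

/-- The bipartite simple graph `E` has regular left degree `d` and is a `(k, ε)`-expander: every
nonempty set `S` of at most `k` left nodes has more than `(1 - ε) d |S|` neighbours. -/
def IsExpander {n m : ℕ} (E : Fin n → Fin m → Prop) (d k : ℕ) (ε : ℝ) : Prop :=
  (∀ a, (neighbors E {a}).card = d) ∧
    ∀ S : Finset (Fin n), S.Nonempty → S.card ≤ k →
      (1 - ε) * (d : ℝ) * (S.card : ℝ) < ((neighbors E S).card : ℝ)

open Classical in
/-- The `m × n` adjacency matrix `F` of the bipartite graph `E`. -/
def adjMatrix {n m : ℕ} (E : Fin n → Fin m → Prop) : Matrix (Fin m) (Fin n) ℝ≥0 :=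
  Matrix.of fun b a => if E a b then 1 else 0

/-- The normalized adjacency matrix `Φ = F / d`. -/
def normalizedAdjMatrix {n m : ℕ} (E : Fin n → Fin m → Prop) (d : ℕ) :
    Matrix (Fin m) (Fin n) ℝ≥0 :=
  (d : ℝ≥0)⁻¹ • adjMatrix E

/-- The law `ℙ_g` on `ℤ₊ᵐ` of a vector with independent coordinates `y_j ~ Poisson (g_j)`. -/
def poissonLaw {m : ℕ} (g : Fin m → ℝ≥0) : Measure (Fin m → ℕ) :=
  Measure.pi fun j => poissonMeasure (g j)

/-- The Kraft inequality `∑_{θ ∈ Θ} exp (-pen θ) ≤ 1`. -/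
def SatisfiesKraft {n : ℕ} {Θ : Set (Fin n → ℝ≥0)} (pen : Θ → ℝ≥0) : Prop :=
  ∑' θ : Θ, ENNReal.ofReal (Real.exp (-(pen θ : ℝ))) ≤ 1

/-- The penalized negative log-likelihood `-log ℙ_{Φθ}(y) + 2 pen(θ)`, with value `+∞` when
`ℙ_{Φθ}(y) = 0`. -/
def penalizedNLL {n m : ℕ} (Φ : Matrix (Fin m) (Fin n) ℝ≥0) {Θ : Set (Fin n → ℝ≥0)}
    (pen : Θ → ℝ≥0) (y : Fin m → ℕ) (θ : Θ) : EReal :=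
  -ENNReal.log (poissonLaw (Φ *ᵥ (θ : Fin n → ℝ≥0)) {y}) + ((2 * (pen θ : ℝ) : ℝ) : EReal)

/-- `θhat` is a penalized maximum likelihood estimator over `Θ`: for every observation `y`,
`θhat y` minimizes the penalized negative log-likelihood over `Θ`. -/
def IsPMLE {n m : ℕ} (Φ : Matrix (Fin m) (Fin n) ℝ≥0) {Θ : Set (Fin n → ℝ≥0)}
    (pen : Θ → ℝ≥0) (θhat : (Fin m → ℕ) → Θ) : Prop :=
  ∀ y, ∀ θ : Θ, penalizedNLL Φ pen y (θhat y) ≤ penalizedNLL Φ pen y θ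

/-- The expected `ℓ₁` risk `𝔼_{Φθ*} ‖θhat(y) - θ*‖₁`. -/
def l1Risk {n m : ℕ} (Φ : Matrix (Fin m) (Fin n) ℝ≥0) (θstar : Fin n → ℝ≥0)
    (θhat : (Fin m → ℕ) → (Fin n → ℝ≥0)) : ℝ≥0∞ :=
  ∫⁻ y, ENNReal.ofReal (l1Norm fun i => (θhat y i : ℝ) - (θstar i : ℝ))
    ∂(poissonLaw (Φ *ᵥ θstar))

/-- The oracle objective `KL(ℙ_{Φθ*} ‖ ℙ_{Φθ}) + 2 pen(θ)`, with values in `[0, ∞]`. -/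
def oracleObjective {n m : ℕ} (Φ : Matrix (Fin m) (Fin n) ℝ≥0) (θstar : Fin n → ℝ≥0)
    {Θ : Set (Fin n → ℝ≥0)} (pen : Θ → ℝ≥0) (θ : Θ) : ℝ≥0∞ :=
  InformationTheory.klDiv (poissonLaw (Φ *ᵥ θstar)) (poissonLaw (Φ *ᵥ (θ : Fin n → ℝ≥0)))
    + 2 * (pen θ : ℝ≥0∞)

end PoissonExpander

end

/-!
The risk bound has a deterministic half and a statistical half.

*Deterministic half.* Let `u = θhat - θ*`. Since `‖θhat‖₁ ≤ L = ‖θ*‖₁`, the mass of `u` is at most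
twice its mass on the `k` largest positions of `θ*` plus twice `‖θ* - θ*⁽ᵏ⁾‖₁`
(`l1Norm_sub_le_of_l1Norm_le`). On an expander, no `k` coordinates carry more than about
`2 ε / (1 - 2 ε)` of the mass of `u` unless `Φ u` is large (`IsExpander.sum_abs_le`). To see this, take the `k`
largest coordinates of `|u|` and let each of their neighbours be represented by its largest
coordinate among them. The remaining edges into this neighbourhood, the collisions, are few in each
superlevel set of `|u|`, by expansion, and integration over the level bounds their total weight.
With `ε = 1/16` the two facts give `‖u‖₁ ≤ 4 ‖θ* - θ*⁽ᵏ⁾‖₁ + 4 ‖Φ u‖₁`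
(`IsExpander.l1Norm_sub_le`). The columns of `Φ` sum to one, so Cauchy–Schwarz bounds `‖Φ u‖₁` by
`2 √(L H²)`, where `H² = ∑ⱼ (√(Φ θ*)ⱼ - √(Φ θhat)ⱼ)²` (`sum_abs_sub_le_sqrt_hellingerSq`).

*Statistical half.* It remains to prove `𝔼 H² ≤ KL + 2 pen θ` for every `θ` in the model; Jensen's
inequality then gives the claim. This is the argument of Li and Barron. It needs no computation of a
Hellinger affinity, because of the pointwise identity `p_{√(gh)}² = exp (H²) p_g p_h` for Poisson
mass functions (`sq_poissonLaw_real_sqrt_mul`). Taking logarithms, using `log x ≤ x - 1` and the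
minimality of the estimator bounds `H²` by a log-likelihood ratio, `2 pen θ`, and `2 (Z - 1)` with
`Z = exp (-pen θhat) p_{√(gh)} / p_g`. The Kraft inequality yields `𝔼 Z ≤ 1`
(`lintegral_sqrt_likelihood_ratio_le_one`). It also makes the sublevel sets of the penalty finite,
so that the minimum is attained.
-/

namespace PoissonExpander

/-! ### Null-space property of expander adjacency matrices -/

/-- If the partial sums of `f` over all superlevel sets of a nonnegative weight `w` are nonnegative,
then so is the `w`-weighted sum of `f`: write `w i` as the length of the interval `(0, w i]` and
integrate over the level. -/
lemma sum_mul_nonneg_of_superlevel {ι : Type*} (s : Finset ι) (f w : ι → ℝ)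
    (hw : ∀ i ∈ s, 0 ≤ w i) (h : ∀ r > 0, 0 ≤ ∑ i ∈ s with r ≤ w i, f i) :
    0 ≤ ∑ i ∈ s, f i * w i := by
  have hint : ∀ i ∈ s, Integrable ((Set.Ioc 0 (w i)).indicator fun _ : ℝ => f i) := fun i _ =>
    (integrable_indicator_iff measurableSet_Ioc).2 (integrableOn_const (by simp))
  have key : ∑ i ∈ s, f i * w i
      = ∫ r : ℝ, ∑ i ∈ s, (Set.Ioc 0 (w i)).indicator (fun _ : ℝ => f i) r := by
    rw [integral_finsetSum s hint]
    refine Finset.sum_congr rfl fun i hi => ?_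
    rw [integral_indicator_const _ measurableSet_Ioc, Real.volume_real_Ioc_of_le (hw i hi)]
    simp [mul_comm]
  rw [key]
  refine integral_nonneg fun r => ?_
  by_cases hr : 0 < r
  · simpa [Set.indicator_apply, hr, Finset.sum_filter] using h r hr
  · simp [hr]

/-- Among the sets with `k` elements one maximizes the sum of the weights; by exchange, its
weights dominate all weights outside of it. -/
lemma exists_card_eq_isMax_sum {ι : Type*} [Fintype ι] (w : ι → ℝ) {k : ℕ}
    (hk : k ≤ Fintype.card ι) :
    ∃ T : Finset ι, T.card = k ∧ (∀ i ∈ T, ∀ j ∉ T, w j ≤ w i) ∧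
      ∀ S : Finset ι, S.card = k → ∑ i ∈ S, w i ≤ ∑ i ∈ T, w i := by
  classical
  obtain ⟨T, hT, hmax⟩ := Finset.exists_max_image (Finset.powersetCard k Finset.univ)
    (fun S => ∑ i ∈ S, w i) (Finset.powersetCard_nonempty.2 (by simpa using hk))
  have hcard := (Finset.mem_powersetCard.1 hT).2
  have hmax' : ∀ S : Finset ι, S.card = k → ∑ i ∈ S, w i ≤ ∑ i ∈ T, w i := fun S hS =>
    hmax S (Finset.mem_powersetCard.2 ⟨Finset.subset_univ _, hS⟩)
  refine ⟨T, hcard, fun i hi j hj => ?_, hmax'⟩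
  have hj' : j ∉ T.erase i := fun h => hj (Finset.mem_of_mem_erase h)
  have h1 := hmax' (insert j (T.erase i)) (by
    rw [Finset.card_insert_of_notMem hj', Finset.card_erase_add_one hi, hcard])
  rw [Finset.sum_insert hj', ← Finset.add_sum_erase T w hi] at h1
  linarith

variable {n m : ℕ} {E : Fin n → Fin m → Prop}

lemma mem_neighbors {S : Finset (Fin n)} {b : Fin m} :
    b ∈ neighbors E S ↔ ∃ a ∈ S, E a b := by
  simp [neighbors]

lemma mem_neighbors_singleton {a : Fin n} {b : Fin m} : b ∈ neighbors E {a} ↔ E a b := by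
  simp [neighbors]

open Classical in
/-- The number of edges from `i` into the neighbourhood of `T` other than the edges
`(rep b, b)`, where `rep` selects one left node for each right node. -/
noncomputable def collisions (E : Fin n → Fin m → Prop) (T : Finset (Fin n)) (rep : Fin m → Fin n)
    (i : Fin n) : ℕ :=
  ((neighbors E T).filter fun b => E i b ∧ rep b ≠ i).card

open Classical in
lemma card_fiber_add_collisions {d : ℕ} (hd : ∀ a, (neighbors E {a}).card = d)
    {T : Finset (Fin n)} {rep : Fin m → Fin n} (hrep : ∀ b ∈ neighbors E T, E (rep b) b)
    {i : Fin n} (hi : i ∈ T) :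
    ((neighbors E T).filter fun b => rep b = i).card + collisions E T rep i = d := by
  rw [collisions, ← Finset.card_union_of_disjoint, ← hd i]
  · congr 1
    ext b
    simp only [Finset.mem_union, Finset.mem_filter, mem_neighbors_singleton]
    constructor
    · rintro (⟨hb, rfl⟩ | ⟨-, h, -⟩)
      exacts [hrep b hb, h]
    · intro h
      have hb : b ∈ neighbors E T := mem_neighbors.2 ⟨i, hi, h⟩
      by_cases hbi : rep b = i
      exacts [Or.inl ⟨hb, hbi⟩, Or.inr ⟨hb, h, hbi⟩]
  · refine Finset.disjoint_filter.2 fun b _ h1 h2 => h2.2 h1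

/-- A subset `U` of `T` that contains the representative of each of its neighbours has at most
`d |U| - |N(U)|` collisions. -/
lemma sum_collisions_add_card_neighbors_le {d : ℕ} (hd : ∀ a, (neighbors E {a}).card = d)
    {T U : Finset (Fin n)} {rep : Fin m → Fin n} (hrep : ∀ b ∈ neighbors E T, E (rep b) b)
    (hU : U ⊆ T) (hUrep : ∀ b ∈ neighbors E U, rep b ∈ U) :
    ∑ i ∈ U, collisions E T rep i + (neighbors E U).card ≤ d * U.card := by
  classical
  have hsub : neighbors E U ⊆ U.biUnion fun i => (neighbors E T).filter fun b => rep b = i := by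
    intro b hb
    obtain ⟨a, ha, hab⟩ := mem_neighbors.1 hb
    simp only [Finset.mem_biUnion, Finset.mem_filter]
    exact ⟨rep b, hUrep b hb, mem_neighbors.2 ⟨a, hU ha, hab⟩, rfl⟩
  have h1 := (Finset.card_le_card hsub).trans Finset.card_biUnion_le
  have h2 : ∑ i ∈ U, (((neighbors E T).filter fun b => rep b = i).card + collisions E T rep i)
      = d * U.card := by
    rw [Finset.sum_congr rfl fun i hi => card_fiber_add_collisions hd hrep (hU hi)]
    simp [mul_comm]
  rw [Finset.sum_add_distrib] at h2
  omega

/-- Edges leaving a set `V` of further nodes either reach new neighbours or collide. -/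
lemma card_neighbors_union_add_sum_collisions_le {d : ℕ}
    (hd : ∀ a, (neighbors E {a}).card = d) (T V : Finset (Fin n)) (rep : Fin m → Fin n) :
    (neighbors E (T ∪ V)).card + ∑ i ∈ V, collisions E T rep i
      ≤ (neighbors E T).card + d * V.card := by
  classical
  have hsub : neighbors E (T ∪ V)
      ⊆ neighbors E T ∪ V.biUnion fun i => neighbors E {i} \ neighbors E T := by
    intro b hb
    obtain ⟨a, ha, hab⟩ := mem_neighbors.1 hb
    by_cases hbT : b ∈ neighbors E T
    · exact Finset.mem_union_left _ hbT
    · refine Finset.mem_union_right _ (Finset.mem_biUnion.2 ⟨a, ?_, ?_⟩)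
      · exact (Finset.mem_union.1 ha).resolve_left fun h => hbT (mem_neighbors.2 ⟨a, h, hab⟩)
      · exact Finset.mem_sdiff.2 ⟨mem_neighbors_singleton.2 hab, hbT⟩
  have h1 := (Finset.card_le_card hsub).trans (Finset.card_union_le _ _)
  have h2 : (V.biUnion fun i => neighbors E {i} \ neighbors E T).card
      ≤ ∑ i ∈ V, (neighbors E {i} \ neighbors E T).card := Finset.card_biUnion_le
  have h3 : ∑ i ∈ V, ((neighbors E {i} \ neighbors E T).card + collisions E T rep i)
      ≤ ∑ _i ∈ V, d := by
    refine Finset.sum_le_sum fun i _ => ?_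
    rw [← hd i, ← Finset.card_sdiff_add_card_inter (neighbors E {i}) (neighbors E T)]
    refine Nat.add_le_add_left (Finset.card_le_card fun b hb => ?_) _
    rw [Finset.mem_filter] at hb
    exact Finset.mem_inter.2 ⟨mem_neighbors_singleton.2 hb.2.1, hb.1⟩
  rw [Finset.sum_add_distrib, Finset.sum_const, smul_eq_mul, mul_comm] at h3
  omega

/-- Non-strict expansion, which also holds for the empty set. -/
lemma IsExpander.le_card_neighbors {d K : ℕ} {ε : ℝ} (hE : IsExpander E d K ε)
    {S : Finset (Fin n)} (hS : S.card ≤ K) :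
    (1 - ε) * d * S.card ≤ (neighbors E S).card := by
  rcases S.eq_empty_or_nonempty with rfl | hne
  · simp
  · exact (hE.2 S hne hS).le

/-- In an expander for sets of size `2k`, a set `V` of nodes outside a `k`-element set `T`, of any
size, has at most about `2 ε d |V|` edges into the neighbourhood of `T`: cut `V` into pieces of size
`k` and use the expansion of the union of each piece with `T`. -/
lemma IsExpander.sum_collisions_le_of_disjoint {d k : ℕ} {ε : ℝ} (hε : 0 ≤ ε) (hk : 1 ≤ k)
    (hE : IsExpander E d (2 * k) ε) {T : Finset (Fin n)} {rep : Fin m → Fin n}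
    (hrep : ∀ b ∈ neighbors E T, E (rep b) b ∧ rep b ∈ T) (hT : T.card = k)
    (V : Finset (Fin n)) (hV : Disjoint T V) :
    (∑ i ∈ V, collisions E T rep i : ℝ) ≤ 2 * ε * d * V.card + ε * d * k := by
  classical
  -- A piece of size at most `k`.
  have piece : ∀ B : Finset (Fin n), Disjoint T B → B.card ≤ k →
      (∑ i ∈ B, collisions E T rep i : ℝ) ≤ ε * d * (k + B.card) := by
    intro B hB hBk
    have hcard : (T ∪ B).card = k + B.card := by rw [Finset.card_union_of_disjoint hB, hT]
    have h1 := hE.le_card_neighbors (S := T ∪ B) (by omega)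
    have h2 := card_neighbors_union_add_sum_collisions_le hE.1 T B rep
    have h3 := sum_collisions_add_card_neighbors_le hE.1 (fun b hb => (hrep b hb).1)
      subset_rfl (fun b hb => (hrep b hb).2)
    have h4 : (neighbors E (T ∪ B)).card + ∑ i ∈ B, collisions E T rep i
        ≤ d * (k + B.card) := by rw [mul_add]; rw [hT] at h3; omega
    have h5 : ((neighbors E (T ∪ B)).card : ℝ) + ∑ i ∈ B, (collisions E T rep i : ℝ)
        ≤ d * (k + B.card) := by exact_mod_cast h4
    rw [hcard] at h1
    push_cast at h1
    linarith
  induction V using Finset.strongInduction with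
  | H V ih =>
    by_cases hVk : V.card ≤ k
    · refine (piece V hV hVk).trans ?_
      have : 0 ≤ ε * d * V.card := by positivity
      linarith
    · obtain ⟨B, hBV, hBk⟩ := Finset.exists_subset_card_eq (not_le.1 hVk).le
      have hlt : V \ B ⊂ V := Finset.sdiff_ssubset hBV (Finset.card_pos.1 (by omega))
      have h1 := piece B (hV.mono_right hBV) hBk.le
      have h2 := ih _ hlt (hV.mono_right hlt.subset)
      have h3 := Finset.card_sdiff_add_card_eq_card hBV
      have h4 : (V.card : ℝ) = (V \ B).card + k := by rw [← h3, hBk]; push_cast; ring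
      rw [← Finset.sum_sdiff hBV, h4]
      rw [hBk] at h1
      linarith

/-- Both on `T` and on the set of all left nodes, the collisions in a superlevel set of `w` amount
to at most a fraction `2 ε` of all edges, if `T` carries the `k` largest values of `w` and `rep`
selects a node of `T` of largest value. -/
lemma IsExpander.sum_collisions_superlevel_le {d k : ℕ} {ε : ℝ} (hε : 0 ≤ ε) (hk : 1 ≤ k)
    (hE : IsExpander E d (2 * k) ε) {T : Finset (Fin n)} {rep : Fin m → Fin n} {w : Fin n → ℝ}
    (hrep : ∀ b ∈ neighbors E T, (E (rep b) b ∧ rep b ∈ T) ∧ ∀ i ∈ T, E i b → w i ≤ w (rep b))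
    (hT : T.card = k) (htop : ∀ i ∈ T, ∀ j ∉ T, w j ≤ w i) (r : ℝ) :
    (∑ i ∈ T with r ≤ w i, collisions E T rep i : ℝ) ≤ 2 * ε * d * (T.filter (r ≤ w ·)).card ∧
    (∑ i with r ≤ w i, collisions E T rep i : ℝ)
      ≤ 2 * ε * d * (Finset.univ.filter (r ≤ w ·)).card := by
  classical
  have hsub : (∑ i ∈ T with r ≤ w i, collisions E T rep i : ℝ)
      ≤ ε * d * (T.filter (r ≤ w ·)).card := by
    have hUT : T.filter (r ≤ w ·) ⊆ T := Finset.filter_subset _ _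
    have h1 := sum_collisions_add_card_neighbors_le hE.1 (fun b hb => (hrep b hb).1.1) hUT (by
      intro b hb
      obtain ⟨a, ha, hab⟩ := mem_neighbors.1 hb
      rw [Finset.mem_filter] at ha
      have h := hrep b (mem_neighbors.2 ⟨a, ha.1, hab⟩)
      exact Finset.mem_filter.2 ⟨h.1.2, ha.2.trans (h.2 a ha.1 hab)⟩)
    have h2 := hE.le_card_neighbors (S := T.filter (r ≤ w ·))
      ((Finset.card_le_card hUT).trans (by omega))
    have h3 : (∑ i ∈ T with r ≤ w i, collisions E T rep i : ℝ)
        + (neighbors E (T.filter (r ≤ w ·))).card ≤ d * (T.filter (r ≤ w ·)).card := by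
      exact_mod_cast h1
    linarith
  have hsub' : (∑ i ∈ T with r ≤ w i, collisions E T rep i : ℝ)
      ≤ 2 * ε * d * (T.filter (r ≤ w ·)).card := by
    have : 0 ≤ ε * d * (T.filter (r ≤ w ·)).card := by positivity
    linarith
  refine ⟨hsub', ?_⟩
  by_cases hlow : ∃ i ∈ T, w i < r
  · -- The superlevel set is contained in `T`.
    obtain ⟨i, hi, hir⟩ := hlow
    have : Finset.univ.filter (r ≤ w ·) = T.filter (r ≤ w ·) := by
      ext j
      simp only [Finset.mem_filter, Finset.mem_univ, true_and]
      refine ⟨fun h => ⟨?_, h⟩, fun h => h.2⟩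
      by_contra hj
      exact absurd (htop i hi j hj) (by linarith)
    rw [this]
    exact hsub'
  · -- The superlevel set contains `T`.
    push Not at hlow
    have hTT : T.filter (r ≤ w ·) = T := Finset.filter_true_of_mem hlow
    have hTU : T ⊆ Finset.univ.filter (r ≤ w ·) := fun i hi => by simpa using hlow i hi
    have h1 := hE.sum_collisions_le_of_disjoint hε hk (fun b hb => (hrep b hb).1) hT
      (Finset.univ.filter (r ≤ w ·) \ T) Finset.disjoint_sdiff
    rw [hTT, hT] at hsub
    have h3 : ((Finset.univ.filter (r ≤ w ·)).card : ℝ)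
        = (Finset.univ.filter (r ≤ w ·) \ T).card + k := by
      rw [← hT]; exact_mod_cast (Finset.card_sdiff_add_card_eq_card hTU).symm
    rw [← Finset.sum_sdiff hTU, h3]
    linarith

open Classical in
/-- Bound from below for `‖F u‖₁`: on a neighbour `b` of `T`, the entry of `F u` is at least
`|u (rep b)|` minus the absolute values of all other terms. -/
lemma sum_sub_collisions_le_sum_abs {d : ℕ} (hd : ∀ a, (neighbors E {a}).card = d)
    {T : Finset (Fin n)} {rep : Fin m → Fin n}
    (hrep : ∀ b ∈ neighbors E T, E (rep b) b ∧ rep b ∈ T) (u : Fin n → ℝ) :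
    ∑ i ∈ T, ((d : ℝ) - collisions E T rep i) * |u i| - ∑ i, (collisions E T rep i : ℝ) * |u i|
      ≤ ∑ b, |∑ i, if E i b then u i else 0| := by
  have hpt : ∀ b ∈ neighbors E T,
      |u (rep b)| - ∑ i, (if E i b ∧ rep b ≠ i then |u i| else 0)
        ≤ |∑ i, if E i b then u i else 0| := by
    intro b hb
    have hsplit : ∑ i, (if E i b then u i else 0)
        = u (rep b) + ∑ i, (if E i b ∧ rep b ≠ i then u i else 0) := by
      rw [← Finset.add_sum_erase _ _ (Finset.mem_univ (rep b)), if_pos (hrep b hb).1]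
      congr 1
      rw [← Finset.add_sum_erase (a := rep b) _ (fun i => if E i b ∧ rep b ≠ i then u i else 0)
        (Finset.mem_univ _)]
      simp only [ne_eq, not_true_eq_false, and_false, if_false, zero_add]
      refine Finset.sum_congr rfl fun i hi => ?_
      simp [(Finset.ne_of_mem_erase hi).symm]
    have habs : |∑ i, (if E i b ∧ rep b ≠ i then u i else 0)|
        ≤ ∑ i, (if E i b ∧ rep b ≠ i then |u i| else 0) := by
      refine (Finset.abs_sum_le_sum_abs _ _).trans (Finset.sum_le_sum fun i _ => ?_)
      split_ifs <;> simp
    rw [hsplit]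
    have := abs_sub_abs_le_abs_sub (u (rep b)) (-∑ i, (if E i b ∧ rep b ≠ i then u i else 0))
    rw [abs_neg, sub_neg_eq_add] at this
    linarith
  have h1 : ∑ b ∈ neighbors E T, |u (rep b)|
      = ∑ i ∈ T, ((d : ℝ) - collisions E T rep i) * |u i| := by
    rw [← Finset.sum_fiberwise_of_maps_to (g := rep) (t := T) fun b hb => (hrep b hb).2]
    refine Finset.sum_congr rfl fun i hi => ?_
    rw [← card_fiber_add_collisions hd (fun b hb => (hrep b hb).1) hi]
    rw [Finset.sum_congr rfl (g := fun _ => |u i|) fun b hb => by rw [(Finset.mem_filter.1 hb).2]]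
    simp
  have h2 : ∑ b ∈ neighbors E T, ∑ i, (if E i b ∧ rep b ≠ i then |u i| else 0)
      = ∑ i, (collisions E T rep i : ℝ) * |u i| := by
    rw [Finset.sum_comm]
    refine Finset.sum_congr rfl fun i _ => ?_
    rw [← Finset.sum_filter]
    simp [collisions]
  rw [← h1, ← h2, ← Finset.sum_sub_distrib]
  exact (Finset.sum_le_sum hpt).trans
    (Finset.sum_le_sum_of_subset_of_nonneg (Finset.subset_univ _) fun _ _ _ => abs_nonneg _)

open Classical in
/-- The robust null-space property of an expander: no `k` coordinates of `u` can carry much more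
than a fraction `2 ε / (1 - 2 ε)` of the mass of `u`, unless `F u` is large. -/
lemma IsExpander.sum_abs_le {d k : ℕ} {ε : ℝ} (hε : 0 ≤ ε) (hk : 1 ≤ k)
    (hE : IsExpander E d (2 * k) ε) (u : Fin n → ℝ) {S : Finset (Fin n)} (hS : S.card = k)
    (hε' : ε ≤ 1 / 2) :
    (1 - 2 * ε) * d * ∑ i ∈ S, |u i|
      ≤ ∑ b, |∑ i, if E i b then u i else 0| + 2 * ε * d * ∑ i, |u i| := by
  obtain ⟨T, hT, htop, hmax⟩ := exists_card_eq_isMax_sum (fun i => |u i|) (k := k)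
    (by rw [← hS]; exact Finset.card_le_univ S)
  have hex : ∀ b, ∃ a, b ∈ neighbors E T → (E a b ∧ a ∈ T) ∧ ∀ i ∈ T, E i b → |u i| ≤ |u a| := by
    intro b
    by_cases hb : b ∈ neighbors E T
    · obtain ⟨a, ha, hab⟩ := mem_neighbors.1 hb
      obtain ⟨c, hc, hcmax⟩ := Finset.exists_max_image (T.filter (E · b)) (fun i => |u i|)
        ⟨a, Finset.mem_filter.2 ⟨ha, hab⟩⟩
      rw [Finset.mem_filter] at hc
      exact ⟨c, fun _ => ⟨⟨hc.2, hc.1⟩, fun i hi hib => hcmax i (Finset.mem_filter.2 ⟨hi, hib⟩)⟩⟩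
    · have : 0 < T.card := by omega
      obtain ⟨a, -⟩ := Finset.card_pos.1 this
      exact ⟨a, fun h => absurd h hb⟩
  choose rep hrep using hex
  have hlev := hE.sum_collisions_superlevel_le hε hk hrep hT htop
  have hA := sum_mul_nonneg_of_superlevel T (fun i => 2 * ε * d - collisions E T rep i)
    (fun i => |u i|) (fun i _ => abs_nonneg _) (fun r _ => by
      rw [Finset.sum_sub_distrib, Finset.sum_const, nsmul_eq_mul, mul_comm]
      exact sub_nonneg.2 (hlev r).1)
  have hB := sum_mul_nonneg_of_superlevel Finset.univ (fun i => 2 * ε * d - collisions E T rep i)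
    (fun i => |u i|) (fun i _ => abs_nonneg _) (fun r _ => by
      rw [Finset.sum_sub_distrib, Finset.sum_const, nsmul_eq_mul, mul_comm]
      exact sub_nonneg.2 (hlev r).2)
  have hC := sum_sub_collisions_le_sum_abs hE.1 (fun b hb => (hrep b hb).1) u
  simp only [sub_mul, Finset.sum_sub_distrib, ← Finset.mul_sum] at hA hB hC
  have hST := mul_le_mul_of_nonneg_left (hmax S hS)
    (mul_nonneg (by linarith : 0 ≤ 1 - 2 * ε) (Nat.cast_nonneg d))
  linarith

lemma l1Norm_coe (θ : Fin n → ℝ≥0) : l1Norm (fun i => (θ i : ℝ)) = ∑ i, (θ i : ℝ) := by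
  simp [l1Norm]

open Classical in
lemma normalizedAdjMatrix_mulVec (d : ℕ) (θ : Fin n → ℝ≥0) (b : Fin m) :
    (((normalizedAdjMatrix E d *ᵥ θ) b : ℝ≥0) : ℝ)
      = (d : ℝ)⁻¹ * ∑ i, if E i b then (θ i : ℝ) else 0 := by
  simp [normalizedAdjMatrix, adjMatrix, Matrix.mulVec, dotProduct, apply_ite, Finset.mul_sum]

/-- The columns of the normalized adjacency matrix sum to one, so it preserves the mass of a
nonnegative vector. -/
lemma sum_normalizedAdjMatrix_mulVec {d : ℕ} (hd : ∀ a, (neighbors E {a}).card = d)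
    (hd0 : 0 < d) (θ : Fin n → ℝ≥0) :
    ∑ b, (((normalizedAdjMatrix E d *ᵥ θ) b : ℝ≥0) : ℝ) = ∑ i, (θ i : ℝ) := by
  classical
  simp_rw [normalizedAdjMatrix_mulVec]
  rw [← Finset.mul_sum, Finset.sum_comm]
  have : ∀ i, ∑ b, (if E i b then (θ i : ℝ) else 0) = d * θ i := by
    intro i
    rw [← Finset.sum_filter, Finset.sum_const, nsmul_eq_mul, ← hd i]
    congr 3
    ext b
    simp [mem_neighbors_singleton]
  simp_rw [this]
  rw [← Finset.mul_sum, inv_mul_cancel_left₀ (by positivity)]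

lemma IsExpander.degree_pos {d K : ℕ} {ε : ℝ} (hE : IsExpander E d K ε) (hK : 1 ≤ K)
    (hn : 0 < n) : 0 < d := by
  rcases Nat.eq_zero_or_pos d with rfl | h
  · have h1 := hE.2 {⟨0, hn⟩} (Finset.singleton_nonempty _) (by simpa using hK)
    rw [hE.1] at h1
    simp at h1
  · exact h

/-- If `‖x'‖₁ ≤ ‖x‖₁`, then outside `S` the difference `x' - x` carries at most its mass on `S` plus
twice the mass of `x` outside `S`. -/
lemma l1Norm_sub_le_of_l1Norm_le (x x' : Fin n → ℝ) (h : l1Norm x' ≤ l1Norm x)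
    (S : Finset (Fin n)) :
    l1Norm (fun i => x' i - x i)
      ≤ 2 * ∑ i ∈ S, |x' i - x i| + 2 * l1Norm (fun i => x i - restrictTo S x i) := by
  have hpt : ∀ i, |x' i - x i| ≤ (|x' i| - |x i|)
      + 2 * (if i ∈ S then |x' i - x i| else 0) + 2 * |x i - restrictTo S x i| := by
    intro i
    by_cases hi : i ∈ S
    · simp only [restrictTo, hi, if_true, sub_self, abs_zero]
      have := abs_sub_abs_le_abs_sub (x i) (x' i)
      rw [abs_sub_comm] at this
      linarith
    · simp only [restrictTo, hi, if_false, sub_zero]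
      have := abs_sub (x' i) (x i)
      linarith
  have hsum := Finset.sum_le_sum fun i (_ : i ∈ Finset.univ) => hpt i
  rw [Finset.sum_add_distrib, Finset.sum_add_distrib, Finset.sum_sub_distrib, ← Finset.mul_sum,
    ← Finset.mul_sum, ← Finset.sum_filter, Finset.filter_mem_eq_inter, Finset.univ_inter] at hsum
  simp only [l1Norm] at h ⊢
  linarith

/-- Instance-optimal recovery: a vector of no larger norm than `θ` is close to `θ` if `θ` is nearly
`k`-sparse and the images of the two vectors under the normalized adjacency matrix are close. -/
lemma IsExpander.l1Norm_sub_le {d k : ℕ} (hk : 1 ≤ k) (hE : IsExpander E d (2 * k) (1 / 16))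
    (θ θ' : Fin n → ℝ≥0)
    (h : l1Norm (fun i => (θ' i : ℝ)) ≤ l1Norm (fun i => (θ i : ℝ))) {S : Finset (Fin n)}
    (hS : S.card = k) :
    l1Norm (fun i => (θ' i : ℝ) - θ i)
      ≤ 4 * l1Norm (fun i => (θ i : ℝ) - restrictTo S (fun i => (θ i : ℝ)) i)
        + 4 * ∑ b, |(((normalizedAdjMatrix E d *ᵥ θ') b : ℝ≥0) : ℝ)
            - ((normalizedAdjMatrix E d *ᵥ θ) b : ℝ≥0)| := by
  classical
  have hn : 0 < n := by
    have := Finset.card_le_univ S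
    simp at this
    omega
  have hd : (0 : ℝ) < d := by exact_mod_cast hE.degree_pos (by omega) hn
  have h1 := l1Norm_sub_le_of_l1Norm_le (fun i => (θ i : ℝ)) (fun i => (θ' i : ℝ)) h S
  have h2 := hE.sum_abs_le (by norm_num) hk (fun i => (θ' i : ℝ) - θ i) hS (by norm_num)
  have h3 : ∀ b, |(((normalizedAdjMatrix E d *ᵥ θ') b : ℝ≥0) : ℝ)
      - ((normalizedAdjMatrix E d *ᵥ θ) b : ℝ≥0)|
      = (d : ℝ)⁻¹ * |∑ i, if E i b then (θ' i : ℝ) - θ i else 0| := by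
    intro b
    rw [normalizedAdjMatrix_mulVec, normalizedAdjMatrix_mulVec, ← mul_sub,
      ← Finset.sum_sub_distrib, abs_mul, abs_of_pos (inv_pos.2 hd)]
    congr 3
    ext i
    split_ifs <;> simp
  simp_rw [h3]
  rw [← Finset.mul_sum]
  have hσ : 0 ≤ l1Norm (fun i => (θ i : ℝ) - restrictTo S (fun i => (θ i : ℝ)) i) :=
    Finset.sum_nonneg fun _ _ => abs_nonneg _
  have hy : 0 ≤ l1Norm (fun i => (θ' i : ℝ) - θ i) := Finset.sum_nonneg fun _ _ => abs_nonneg _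
  have h4 : 0 ≤ (d : ℝ)⁻¹ * ∑ b, |∑ i, if E i b then (θ' i : ℝ) - θ i else 0| := by positivity
  have h5 : (1 - 2 * (1 / 16)) * ∑ i ∈ S, |(θ' i : ℝ) - θ i|
      ≤ (d : ℝ)⁻¹ * ∑ b, |∑ i, if E i b then (θ' i : ℝ) - θ i else 0|
        + 2 * (1 / 16) * l1Norm (fun i => (θ' i : ℝ) - θ i) := by
    have := mul_le_mul_of_nonneg_left h2 (inv_pos.2 hd).le
    rw [l1Norm]
    field_simp at this ⊢
    linarith
  linarith

/-! ### The Hellinger distance between Poisson laws -/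

/-- The sum of `(√(g j) - √(h j))²`, which is minus twice the logarithm of the Hellinger affinity of
the Poisson laws with intensities `g` and `h`. -/
noncomputable def hellingerSq (g h : Fin m → ℝ≥0) : ℝ :=
  ∑ j, (√(g j : ℝ) - √(h j : ℝ)) ^ 2

lemma hellingerSq_nonneg (g h : Fin m → ℝ≥0) : 0 ≤ hellingerSq g h :=
  Finset.sum_nonneg fun _ _ => sq_nonneg _

/-- Cauchy–Schwarz applied to `|a - b| = |√a - √b| (√a + √b)`. -/
lemma sum_abs_sub_le_sqrt_hellingerSq {g h : Fin m → ℝ≥0} {L : ℝ} (hg : ∑ j, (g j : ℝ) ≤ L)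
    (hh : ∑ j, (h j : ℝ) ≤ L) :
    ∑ j, |(h j : ℝ) - g j| ≤ 2 * √(L * hellingerSq g h) := by
  have hL : 0 ≤ L := le_trans (Finset.sum_nonneg fun _ _ => NNReal.coe_nonneg _) hg
  have h1 : ∀ j, |(h j : ℝ) - g j| = |√(g j : ℝ) - √(h j : ℝ)| * (√(g j : ℝ) + √(h j : ℝ)) := by
    intro j
    rw [← abs_of_nonneg (by positivity : 0 ≤ √(g j : ℝ) + √(h j : ℝ)), ← abs_mul, abs_sub_comm]
    congr 1
    have e1 := Real.sq_sqrt (g j).coe_nonneg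
    have e2 := Real.sq_sqrt (h j).coe_nonneg
    linear_combination -e1 + e2
  have hCS := Finset.sum_mul_sq_le_sq_mul_sq Finset.univ
    (fun j => |√(g j : ℝ) - √(h j : ℝ)|) (fun j => √(g j : ℝ) + √(h j : ℝ))
  have h2 : ∑ j, (√(g j : ℝ) + √(h j : ℝ)) ^ 2 ≤ 4 * L := by
    have : ∀ j, (√(g j : ℝ) + √(h j : ℝ)) ^ 2 ≤ 2 * (g j : ℝ) + 2 * h j := by
      intro j
      have e1 := Real.sq_sqrt (g j).coe_nonneg
      have e2 := Real.sq_sqrt (h j).coe_nonneg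
      linarith [sq_nonneg (√(g j : ℝ) - √(h j : ℝ))]
    refine (Finset.sum_le_sum fun j _ => this j).trans ?_
    rw [Finset.sum_add_distrib, ← Finset.mul_sum, ← Finset.mul_sum]
    linarith
  simp_rw [← h1, sq_abs] at hCS
  have h3 : (∑ j, |(h j : ℝ) - g j|) ^ 2 ≤ 4 * (L * hellingerSq g h) := by
    refine hCS.trans ((mul_le_mul_of_nonneg_left h2 (hellingerSq_nonneg g h)).trans_eq ?_)
    ring
  refine (Real.le_sqrt_of_sq_le h3).trans_eq ?_
  rw [Real.sqrt_mul (by norm_num), show (4 : ℝ) = 2 ^ 2 by norm_num, Real.sqrt_sq (by norm_num)]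

instance (g : Fin m → ℝ≥0) : IsProbabilityMeasure (poissonLaw g) := by
  unfold poissonLaw; infer_instance

lemma poissonLaw_real_singleton (g : Fin m → ℝ≥0) (y : Fin m → ℕ) :
    (poissonLaw g).real {y}
      = ∏ j, Real.exp (-(g j : ℝ)) * (g j : ℝ) ^ y j / ((y j).factorial : ℝ) := by
  simp_rw [← poissonMeasure_real_singleton]
  simp [poissonLaw, measureReal_def, ENNReal.toReal_prod]

/-- The geometric mean of two Poisson laws is a multiple of the Poisson law whose intensity is the
geometric mean of the intensities. -/
lemma sq_poissonLaw_real_sqrt_mul (g h : Fin m → ℝ≥0) (y : Fin m → ℕ) :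
    (poissonLaw fun j => NNReal.sqrt (g j * h j)).real {y} ^ 2
      = Real.exp (hellingerSq g h) * (poissonLaw g).real {y} * (poissonLaw h).real {y} := by
  simp_rw [poissonLaw_real_singleton, hellingerSq, Real.exp_sum, ← Finset.prod_pow,
    ← Finset.prod_mul_distrib]
  refine Finset.prod_congr rfl fun j _ => ?_
  have e1 := Real.sq_sqrt (g j).coe_nonneg
  have e2 := Real.sq_sqrt (h j).coe_nonneg
  simp only [Real.coe_sqrt, NNReal.coe_mul]
  rw [Real.sqrt_mul (g j).coe_nonneg]
  have hexp : Real.exp (-(√(g j : ℝ) * √(h j : ℝ))) ^ 2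
      = Real.exp ((√(g j : ℝ) - √(h j : ℝ)) ^ 2) * Real.exp (-(g j : ℝ))
        * Real.exp (-(h j : ℝ)) := by
    rw [← Real.exp_nat_mul, ← Real.exp_add, ← Real.exp_add]
    congr 1
    push_cast
    linear_combination -e1 - e2
  have hpow : ((√(g j : ℝ) * √(h j : ℝ)) ^ y j) ^ 2 = (g j : ℝ) ^ y j * (h j : ℝ) ^ y j := by
    rw [← pow_mul, mul_comm (y j) 2, pow_mul, mul_pow, e1, e2, mul_pow]
  rw [div_pow, mul_pow, hexp, hpow]
  ring

/-- The pointwise form of the bound on the risk: the first term on the right has mean at most `2`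
when summed over a model, and the logarithm is a log-likelihood ratio. -/
lemma hellingerSq_le {g h : Fin m → ℝ≥0} {y : Fin m → ℕ} (hg : 0 < (poissonLaw g).real {y})
    (hh : 0 < (poissonLaw h).real {y}) (c : ℝ) :
    hellingerSq g h
      ≤ 2 * (Real.exp (-c) * (poissonLaw fun j => NNReal.sqrt (g j * h j)).real {y}
            / (poissonLaw g).real {y}) - 2
        + (Real.log ((poissonLaw g).real {y}) - Real.log ((poissonLaw h).real {y})) + 2 * c := by
  set q := (poissonLaw fun j => NNReal.sqrt (g j * h j)).real {y} with hq
  have hsq := sq_poissonLaw_real_sqrt_mul g h y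
  rw [← hq] at hsq
  have hq0 : q ≠ 0 := by
    intro h0
    rw [h0] at hsq
    have : 0 < Real.exp (hellingerSq g h) * (poissonLaw g).real {y} * (poissonLaw h).real {y} := by
      positivity
    simp [← hsq] at this
  have hqpos : 0 < q := lt_of_le_of_ne measureReal_nonneg hq0.symm
  have hlog := congrArg Real.log hsq
  rw [Real.log_pow, Real.log_mul (by positivity) hh.ne', Real.log_mul (Real.exp_ne_zero _) hg.ne',
    Real.log_exp] at hlog
  have h1 := Real.log_le_sub_one_of_pos (x := Real.exp (-c) * q / (poissonLaw g).real {y})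
    (by positivity)
  rw [Real.log_div (by positivity) hg.ne', Real.log_mul (Real.exp_ne_zero _) hq0,
    Real.log_exp] at h1
  push_cast at hlog
  linarith

/-! ### The risk bound for the penalized maximum likelihood estimator -/

/-- If `θ` gives positive probability to `y`, then so does every parameter with a smaller objective,
and the objectives compare as real numbers. -/
lemma pos_and_log_le_of_penalizedNLL_le {Φ : Matrix (Fin m) (Fin n) ℝ≥0} {Θ : Set (Fin n → ℝ≥0)}
    {pen : Θ → ℝ≥0} {y : Fin m → ℕ} {θ θ' : Θ}
    (h : penalizedNLL Φ pen y θ' ≤ penalizedNLL Φ pen y θ)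
    (hθ : 0 < (poissonLaw (Φ *ᵥ (θ : Fin n → ℝ≥0))).real {y}) :
    0 < (poissonLaw (Φ *ᵥ (θ' : Fin n → ℝ≥0))).real {y} ∧
      -Real.log ((poissonLaw (Φ *ᵥ (θ' : Fin n → ℝ≥0))).real {y}) + 2 * pen θ'
        ≤ -Real.log ((poissonLaw (Φ *ᵥ (θ : Fin n → ℝ≥0))).real {y}) + 2 * pen θ := by
  have hlog : ∀ θ : Θ, 0 < (poissonLaw (Φ *ᵥ (θ : Fin n → ℝ≥0))).real {y} →
      penalizedNLL Φ pen y θ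
        = ((-Real.log ((poissonLaw (Φ *ᵥ (θ : Fin n → ℝ≥0))).real {y}) + 2 * pen θ : ℝ) :
            EReal) := by
    intro θ hθ
    rw [penalizedNLL, ← ofReal_measureReal, ENNReal.log_ofReal_of_pos hθ]
    norm_cast
  have hpos : 0 < (poissonLaw (Φ *ᵥ (θ' : Fin n → ℝ≥0))).real {y} := by
    refine lt_of_le_of_ne measureReal_nonneg fun h0 => ?_
    rw [hlog θ hθ, penalizedNLL, ← ofReal_measureReal, ← h0, ENNReal.ofReal_zero,
      ENNReal.log_zero, EReal.neg_bot, EReal.top_add_coe, top_le_iff] at h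
    exact EReal.coe_ne_top _ h
  refine ⟨hpos, ?_⟩
  rw [hlog θ hθ, hlog θ' hpos] at h
  exact_mod_cast h

/-- On atoms, the log-likelihood ratio is the difference of the logarithms of the masses. -/
lemma llr_eq_log_sub_log {α : Type*} [MeasurableSpace α] [MeasurableSingletonClass α]
    {μ ν : Measure α} [IsFiniteMeasure μ] [IsFiniteMeasure ν] (hμν : μ ≪ ν) {y : α}
    (hy : 0 < μ.real {y}) :
    0 < ν.real {y} ∧ llr μ ν y = Real.log (μ.real {y}) - Real.log (ν.real {y}) := by
  have hν : 0 < ν.real {y} := by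
    refine lt_of_le_of_ne measureReal_nonneg fun h0 => hy.ne' ?_
    have : ν {y} = 0 := (measureReal_eq_zero_iff).1 h0.symm
    simp [measureReal_def, hμν this]
  refine ⟨hν, ?_⟩
  have h1 := Measure.setLIntegral_rnDeriv hμν {y}
  rw [lintegral_singleton] at h1
  have h2 : (μ.rnDeriv ν y).toReal * ν.real {y} = μ.real {y} := by
    rw [measureReal_def, measureReal_def, ← ENNReal.toReal_mul, h1]
  rw [llr, ← Real.log_div hy.ne' hν.ne', ← h2, mul_div_cancel_right₀ _ hν.ne']

/-- By the Kraft inequality, the normalized and penalized square root likelihood ratio has mean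
at most one at every data-dependent parameter: bound it by the sum over the model, in which
the term of `θ` has mean `exp (-pen θ)`. -/
lemma lintegral_sqrt_likelihood_ratio_le_one (Φ : Matrix (Fin m) (Fin n) ℝ≥0)
    (g : Fin m → ℝ≥0) {Θ : Set (Fin n → ℝ≥0)} {pen : Θ → ℝ≥0} (hpen : SatisfiesKraft pen)
    (θhat : (Fin m → ℕ) → Θ) :
    ∫⁻ y, ENNReal.ofReal (Real.exp (-(pen (θhat y) : ℝ))
        * (poissonLaw fun j => NNReal.sqrt (g j * (Φ *ᵥ (θhat y : Fin n → ℝ≥0)) j)).real {y}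
        / (poissonLaw g).real {y}) ∂(poissonLaw g) ≤ 1 := by
  rw [lintegral_countable']
  have hpt : ∀ y : Fin m → ℕ, ENNReal.ofReal (Real.exp (-(pen (θhat y) : ℝ))
        * (poissonLaw fun j => NNReal.sqrt (g j * (Φ *ᵥ (θhat y : Fin n → ℝ≥0)) j)).real {y}
        / (poissonLaw g).real {y}) * poissonLaw g {y}
      ≤ ∑' θ : Θ, ENNReal.ofReal (Real.exp (-(pen θ : ℝ)))
        * (poissonLaw fun j => NNReal.sqrt (g j * (Φ *ᵥ (θ : Fin n → ℝ≥0)) j)) {y} := by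
    intro y
    refine le_trans ?_ (ENNReal.le_tsum (θhat y))
    rw [← ofReal_measureReal, ← ofReal_measureReal, ← ENNReal.ofReal_mul' measureReal_nonneg,
      ← ENNReal.ofReal_mul' measureReal_nonneg]
    refine ENNReal.ofReal_le_ofReal ?_
    rcases eq_or_ne ((poissonLaw g).real {y}) 0 with h0 | h0
    · rw [h0, mul_zero]
      positivity
    · rw [div_mul_cancel₀ _ h0]
  refine (ENNReal.tsum_le_tsum hpt).trans ?_
  rw [ENNReal.tsum_comm]
  refine le_trans (ENNReal.tsum_le_tsum fun θ => ?_) hpen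
  rw [ENNReal.tsum_mul_left]
  have h1 := lintegral_countable'
    (μ := poissonLaw fun j => NNReal.sqrt (g j * (Φ *ᵥ (θ : Fin n → ℝ≥0)) j)) fun _ => 1
  simp only [lintegral_one, measure_univ, one_mul] at h1
  rw [← h1, mul_one]

/-- The Li–Barron risk bound: the expected Hellinger loss of the penalized maximum likelihood
estimator is at most the oracle objective of every parameter in the model. -/
lemma lintegral_hellingerSq_le_oracleObjective {Φ : Matrix (Fin m) (Fin n) ℝ≥0}
    {Θ : Set (Fin n → ℝ≥0)} {pen : Θ → ℝ≥0} (hpen : SatisfiesKraft pen)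
    {θhat : (Fin m → ℕ) → Θ} (hθhat : IsPMLE Φ pen θhat) (θstar : Fin n → ℝ≥0) (θ : Θ) :
    ∫⁻ y, ENNReal.ofReal
        (hellingerSq (Φ *ᵥ θstar) (Φ *ᵥ (θhat y : Fin n → ℝ≥0))) ∂(poissonLaw (Φ *ᵥ θstar))
      ≤ oracleObjective Φ θstar pen θ := by
  by_cases hKL : InformationTheory.klDiv (poissonLaw (Φ *ᵥ θstar))
      (poissonLaw (Φ *ᵥ (θ : Fin n → ℝ≥0))) = ∞
  · simp [oracleObjective, hKL]
  obtain ⟨hac, hint⟩ := InformationTheory.klDiv_ne_top_iff.1 hKL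
  set g := Φ *ᵥ θstar with hg
  set μ := poissonLaw g with hμ
  set ν := poissonLaw (Φ *ᵥ (θ : Fin n → ℝ≥0)) with hν
  set Z : (Fin m → ℕ) → ℝ := fun y => Real.exp (-(pen (θhat y) : ℝ))
    * (poissonLaw fun j => NNReal.sqrt (g j * (Φ *ᵥ (θhat y : Fin n → ℝ≥0)) j)).real {y}
    / μ.real {y} with hZ
  have hZ0 : ∀ y, 0 ≤ Z y := fun y => by positivity
  have hZ1 : ∫⁻ y, ENNReal.ofReal (Z y) ∂μ ≤ 1 :=
    lintegral_sqrt_likelihood_ratio_le_one Φ g hpen θhat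
  have hZm : AEStronglyMeasurable Z μ := (measurable_of_countable Z).aestronglyMeasurable
  have hZint : Integrable Z μ := by
    refine ⟨hZm, ?_⟩
    rw [hasFiniteIntegral_iff_ofReal (Filter.Eventually.of_forall hZ0)]
    exact hZ1.trans_lt ENNReal.one_lt_top
  have hZmean : ∫ y, Z y ∂μ ≤ 1 := by
    rw [integral_eq_lintegral_of_nonneg_ae (Filter.Eventually.of_forall hZ0) hZm]
    exact ENNReal.toReal_le_of_le_ofReal zero_le_one (by simpa using hZ1)
  set R : (Fin m → ℕ) → ℝ := fun y => (2 * Z y + llr μ ν y) + (2 * (pen θ : ℝ) - 2) with hR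
  have hRint : Integrable R μ := ((hZint.const_mul 2).add hint).add (integrable_const _)
  have hle : ∀ᵐ y ∂μ, hellingerSq g (Φ *ᵥ (θhat y : Fin n → ℝ≥0)) ≤ R y := by
    rw [ae_iff_of_countable]
    intro y hy
    have hy' : 0 < μ.real {y} := ENNReal.toReal_pos hy (measure_ne_top _ _)
    obtain ⟨hνy, hllr⟩ := llr_eq_log_sub_log hac hy'
    obtain ⟨hpos, hmin⟩ := pos_and_log_le_of_penalizedNLL_le (hθhat y θ) hνy
    have h1 := hellingerSq_le hy' hpos (pen (θhat y))
    simp only [hR, hZ, hllr]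
    linarith
  have hRmean : ∫ y, R y ∂μ ≤ ∫ y, llr μ ν y ∂μ + 2 * (pen θ : ℝ) := by
    have h1 : ∫ y, R y ∂μ = ∫ y, (2 * Z y + llr μ ν y) ∂μ + ∫ _, (2 * (pen θ : ℝ) - 2) ∂μ :=
      integral_add ((hZint.const_mul 2).add hint) (integrable_const _)
    have h2 : ∫ y, (2 * Z y + llr μ ν y) ∂μ = ∫ y, 2 * Z y ∂μ + ∫ y, llr μ ν y ∂μ :=
      integral_add (hZint.const_mul 2) hint
    rw [h1, h2, integral_const_mul, integral_const, probReal_univ]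
    simp only [smul_eq_mul, one_mul]
    linarith
  calc ∫⁻ y, ENNReal.ofReal (hellingerSq g (Φ *ᵥ (θhat y : Fin n → ℝ≥0))) ∂μ
      ≤ ∫⁻ y, ENNReal.ofReal (R y) ∂μ :=
        lintegral_mono_ae (hle.mono fun y hy => ENNReal.ofReal_le_ofReal hy)
    _ = ENNReal.ofReal (∫ y, R y ∂μ) := by
        rw [ofReal_integral_eq_lintegral_ofReal hRint
          (hle.mono fun y hy => (hellingerSq_nonneg _ _).trans hy)]
    _ ≤ ENNReal.ofReal (∫ y, llr μ ν y ∂μ + 2 * (pen θ : ℝ)) := ENNReal.ofReal_le_ofReal hRmean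
    _ ≤ ENNReal.ofReal (∫ y, llr μ ν y ∂μ) + ENNReal.ofReal (2 * (pen θ : ℝ)) :=
        ENNReal.ofReal_add_le
    _ = oracleObjective Φ θstar pen θ := by
        rw [oracleObjective, InformationTheory.klDiv_of_ac_of_integrable hac hint]
        simp [ENNReal.ofReal_mul]

/-- The Kraft inequality leaves only finitely many parameters below any finite penalty level, so the
oracle objective attains its minimum. -/
lemma exists_isLeast_range_oracleObjective (Φ : Matrix (Fin m) (Fin n) ℝ≥0)
    (θstar : Fin n → ℝ≥0) {Θ : Set (Fin n → ℝ≥0)} [Nonempty Θ] {pen : Θ → ℝ≥0}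
    (hpen : SatisfiesKraft pen) :
    ∃ M, IsLeast (Set.range (oracleObjective Φ θstar pen)) M := by
  by_cases hfin : ∃ θ₀ : Θ, oracleObjective Φ θstar pen θ₀ ≠ ∞
  · obtain ⟨θ₀, hθ₀⟩ := hfin
    set C := (oracleObjective Φ θstar pen θ₀).toReal with hC
    have hset :
        {θ : Θ | oracleObjective Φ θstar pen θ ≤ oracleObjective Φ θstar pen θ₀}.Finite := by
      refine (ENNReal.finite_const_le_of_tsum_ne_top (ne_top_of_le_ne_top ENNReal.one_ne_top hpen)
        (ε := ENNReal.ofReal (Real.exp (-C))) (by simp [Real.exp_pos])).subset fun θ hθ => ?_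
      have h1 : (pen θ : ℝ≥0∞) ≤ oracleObjective Φ θstar pen θ :=
        calc (pen θ : ℝ≥0∞) ≤ pen θ + pen θ := le_self_add
          _ = 2 * pen θ := (two_mul _).symm
          _ ≤ _ := le_add_self
      have h2 := ENNReal.toReal_mono hθ₀ (h1.trans hθ)
      rw [ENNReal.coe_toReal, ← hC] at h2
      exact ENNReal.ofReal_le_ofReal (Real.exp_le_exp.2 (neg_le_neg h2))
    obtain ⟨θ, hθ, hmin⟩ := Set.exists_min_image _ (oracleObjective Φ θstar pen) hset
      ⟨θ₀, le_refl (oracleObjective Φ θstar pen θ₀)⟩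
    refine ⟨_, ⟨θ, rfl⟩, ?_⟩
    rintro _ ⟨θ', rfl⟩
    rcases le_total (oracleObjective Φ θstar pen θ') (oracleObjective Φ θstar pen θ₀) with h | h
    exacts [hmin θ' h, le_trans hθ h]
  · push Not at hfin
    refine ⟨_, ⟨Classical.arbitrary Θ, rfl⟩, ?_⟩
    rintro _ ⟨θ', rfl⟩
    rw [hfin, hfin]

/-- Jensen's inequality for the square root, under a probability measure. -/
lemma lintegral_rpow_half_le {α : Type*} [MeasurableSpace α] (μ : Measure α)
    [IsProbabilityMeasure μ] {f : α → ℝ≥0∞} (hf : AEMeasurable f μ) :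
    ∫⁻ a, f a ^ (1 / 2 : ℝ) ∂μ ≤ (∫⁻ a, f a ∂μ) ^ (1 / 2 : ℝ) := by
  have h := ENNReal.lintegral_mul_le_Lp_mul_Lq μ Real.HolderConjugate.two_two
    (hf.pow_const (1 / 2 : ℝ)) (aemeasurable_const (b := (1 : ℝ≥0∞)))
  have h2 : ∀ a, (f a ^ (1 / 2 : ℝ)) ^ (2 : ℝ) = f a := fun a => by
    rw [← ENNReal.rpow_mul]; norm_num
  simp_rw [h2] at h
  simpa using h

end PoissonExpander

theorem mainTheorem1 (n m k d : ℕ) (hk : 1 ≤ k) (hkn : 4 * k ≤ n)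
    (E : Fin n → Fin m → Prop) (hE : PoissonExpander.IsExpander E d (2 * k) (1 / 16))
    (L : ℝ≥0) (θstar : Fin n → ℝ≥0)
    (hθstar : PoissonExpander.l1Norm (fun i => (θstar i : ℝ)) = (L : ℝ))
    (θk : Fin n → ℝ)
    (hθk : PoissonExpander.IsBestKTermApprox k (fun i => (θstar i : ℝ)) θk)
    (Θ : Set (Fin n → ℝ≥0)) (hΘ : Θ.Countable)
    (hΘL : ∀ θ ∈ Θ, PoissonExpander.l1Norm (fun i => (θ i : ℝ)) ≤ (L : ℝ))
    (pen : Θ → ℝ≥0) (hpen : PoissonExpander.SatisfiesKraft pen)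
    (θhat : (Fin m → ℕ) → Θ)
    (hθhat : PoissonExpander.IsPMLE (PoissonExpander.normalizedAdjMatrix E d) pen θhat) :
    ∃ M : ℝ≥0∞,
      IsLeast (Set.range (PoissonExpander.oracleObjective
        (PoissonExpander.normalizedAdjMatrix E d) θstar pen)) M ∧
      PoissonExpander.l1Risk (PoissonExpander.normalizedAdjMatrix E d) θstar
          (fun y => (θhat y : Fin n → ℝ≥0)) ≤
        4 * ENNReal.ofReal (PoissonExpander.l1Norm fun i => (θstar i : ℝ) - θk i)
          + 8 * ((L : ℝ≥0∞) * M) ^ (1 / 2 : ℝ) := by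
  open PoissonExpander in
  obtain ⟨S, hS, -, rfl⟩ := hθk
  have : Nonempty Θ := ⟨θhat 0⟩
  obtain ⟨M, hM⟩ := exists_isLeast_range_oracleObjective (normalizedAdjMatrix E d) θstar hpen
  refine ⟨M, hM, ?_⟩
  obtain ⟨θ₀, rfl⟩ := hM.1
  have hd := hE.degree_pos (by omega) (by omega)
  set Φ := normalizedAdjMatrix E d with hΦ
  set μ := poissonLaw (Φ *ᵥ θstar) with hμ
  set σ := l1Norm fun i => (θstar i : ℝ) - restrictTo S (fun i => (θstar i : ℝ)) i with hσ
  have hσ0 : 0 ≤ σ := Finset.sum_nonneg fun _ _ => abs_nonneg _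
  set H : (Fin m → ℕ) → ℝ :=
    fun y => hellingerSq (Φ *ᵥ θstar) (Φ *ᵥ (θhat y : Fin n → ℝ≥0)) with hH
  have hpt : ∀ y, ENNReal.ofReal (l1Norm fun i => ((θhat y : Fin n → ℝ≥0) i : ℝ) - θstar i)
      ≤ 4 * ENNReal.ofReal σ + 8 * ((L : ℝ≥0∞) * ENNReal.ofReal (H y)) ^ (1 / 2 : ℝ) := by
    intro y
    have hθL := hΘL _ (θhat y).2
    have h1 := hE.l1Norm_sub_le hk θstar (θhat y) (hθL.trans_eq hθstar.symm) hS
    have h2 := sum_abs_sub_le_sqrt_hellingerSq (g := Φ *ᵥ θstar)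
      (h := Φ *ᵥ (θhat y : Fin n → ℝ≥0)) (L := L)
      (by rw [hΦ, sum_normalizedAdjMatrix_mulVec hE.1 hd, ← l1Norm_coe, hθstar])
      (by rw [hΦ, sum_normalizedAdjMatrix_mulVec hE.1 hd, ← l1Norm_coe]; exact hθL)
    have h3 : l1Norm (fun i => ((θhat y : Fin n → ℝ≥0) i : ℝ) - θstar i)
        ≤ 4 * σ + 8 * √(L * H y) := by
      simp only [hH]
      linarith
    have hH0 : 0 ≤ H y := hellingerSq_nonneg _ _
    refine (ENNReal.ofReal_le_ofReal h3).trans_eq ?_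
    rw [ENNReal.ofReal_add (by positivity) (by positivity), ENNReal.ofReal_mul (by norm_num),
      ENNReal.ofReal_mul (by norm_num), Real.sqrt_eq_rpow,
      ← ENNReal.ofReal_rpow_of_nonneg (by positivity) (by norm_num),
      ENNReal.ofReal_mul L.coe_nonneg, ENNReal.ofReal_coe_nnreal]
    simp
  calc l1Risk Φ θstar (fun y => (θhat y : Fin n → ℝ≥0))
      ≤ ∫⁻ y, (4 * ENNReal.ofReal σ
          + 8 * ((L : ℝ≥0∞) * ENNReal.ofReal (H y)) ^ (1 / 2 : ℝ)) ∂μ := lintegral_mono hpt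
    _ = 4 * ENNReal.ofReal σ
          + 8 * ∫⁻ y, ((L : ℝ≥0∞) * ENNReal.ofReal (H y)) ^ (1 / 2 : ℝ) ∂μ := by
        rw [lintegral_add_left measurable_const, lintegral_const, measure_univ, mul_one,
          lintegral_const_mul _ (measurable_of_countable _)]
    _ ≤ 4 * ENNReal.ofReal σ
          + 8 * (∫⁻ y, (L : ℝ≥0∞) * ENNReal.ofReal (H y) ∂μ) ^ (1 / 2 : ℝ) := by
        gcongr
        exact lintegral_rpow_half_le μ (measurable_of_countable _).aemeasurable
    _ ≤ 4 * ENNReal.ofReal σ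
          + 8 * ((L : ℝ≥0∞) * oracleObjective Φ θstar pen θ₀) ^ (1 / 2 : ℝ) := by
        rw [lintegral_const_mul _ (measurable_of_countable _)]
        gcongr
        exact lintegral_hellingerSq_le_oracleObjective hpen hθhat θstar θ₀
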